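/- Let $\mathfrak{A}$ and $\mathfrak{B}$ be (complex, not necessarily unital) $C^{*}$-algebras with $\mathfrak{B}\neq\{0\}$. A state of a $C^{*}$-algebra is a bounded linear functional $\phi$ with $\|\phi\|=1$ that is positive, i.e. $\phi(a)\geq 0$ for every positive element $a$; write $\mathcal{S}(\cdot)$ for the set of states. Let $\Psi:\mathfrak{A}\to\mathfrak{B}$ be a linear map (not assumed bounded) whose adjoint maps states to states, i.e. $\phi\circ\Psi\in\mathcal{S}(\mathfrak{A})$ for every $\phi\in\mathcal{S}(\mathfrak{B})$. Then $\Psi$ is positive (it maps positive elements to positive elements), and it is bounded and contractive, $\|\Psi(a)\|\leq\|a\|$ for all $a\in\mathfrak{A}$, with operator norm $\|\Psi\|=1$. If moreover $\mathfrak{A}$ is unital, then $\mathfrak{B}$ is unital and $\Psi(\mathbf{1}_{\mathfrak{A}})=\mathbf{1}_{\mathfrak{B}}$. -/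

import Mathlib

open scoped ComplexOrder

/-- The set of states of a (not necessarily unital) C*-algebra `A`: the positive functionals
of norm one in the Banach space dual of `A`. -/
def cstarStates (A : Type*) [NonUnitalCStarAlgebra A] [PartialOrder A] :
    Set (StrongDual ℂ A) :=
  {φ | (∀ a : A, 0 ≤ a → 0 ≤ φ a) ∧ ‖φ‖ = 1}

/-- `e` is a (two-sided) multiplicative identity of `A`. -/
def IsMulIdentity {A : Type*} [Mul A] (e : A) : Prop :=
  ∀ a : A, e * a = a ∧ a * e = a

/-! States detect positivity, so `Ψ` is positive. They also compute the norm of a positive element,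
so `Ψ` is contractive on positive elements. Together these make the extension `λ + a ↦ λ + Ψ a` to
unitizations positive and unital (`Unitization.norm_negPart_snd_le_of_nonneg`), and a positive
unital map is contractive by Russo–Dye. Composing `Ψ` with one state gives `1 ≤ ‖Ψ‖`. If `e` is a
unit, every state takes the value 1 at `Ψ e`, so `Ψ e` dominates all positive contractions, which
forces it to be a unit. -/

section UnitalPositive

/-! ### Unital algebras: Russo–Dye and functionals with `φ 1 = 1`. -/

variable {A : Type*} [CStarAlgebra A] [PartialOrder A] [StarOrderedRing A]

/-- A normal contraction is approximated by combinations `∑ cᵢ bᵢ`, where the `bᵢ` are positive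
with sum `1` and the scalars `cᵢ` have modulus at most `1`. -/
theorem IsStarNormal.exists_norm_sub_sum_smul_le (u : A) [IsStarNormal u] (hu : ‖u‖ ≤ 1)
    {ε : ℝ} (hε : 0 < ε) :
    ∃ (n : ℕ) (c : Fin n → ℂ) (b : Fin n → A), (∀ i, ‖c i‖ ≤ 1) ∧ (∀ i, 0 ≤ b i) ∧
      ∑ i, b i = 1 ∧ ‖u - ∑ i, c i • b i‖ ≤ ε := by
  obtain _ | _ := subsingleton_or_nontrivial A
  · exact ⟨0, Fin.elim0, Fin.elim0, fun i ↦ i.elim0, fun i ↦ i.elim0, Subsingleton.elim _ _,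
      by simpa [Subsingleton.elim u 0] using hε.le⟩
  obtain ⟨t, hts, htf, htc⟩ := (spectrum.isCompact (𝕜 := ℂ) u).finite_cover_balls hε
  obtain ⟨n, e, he⟩ := htf.fin_embedding
  have hmem (i : Fin n) : e i ∈ t := he ▸ Set.mem_range_self i
  obtain ⟨f, hf, hsum, h01, -⟩ := exists_continuous_sum_one_of_isOpen_isCompact
    (s := fun i ↦ Metric.ball (e i) ε) (fun i ↦ Metric.isOpen_ball) (spectrum.isCompact (𝕜 := ℂ) u)
    (fun z hz ↦ by
      obtain ⟨x, hx, hzx⟩ := Set.mem_iUnion₂.1 (htc hz)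
      obtain ⟨i, rfl⟩ := he ▸ hx
      exact Set.mem_iUnion.2 ⟨i, hzx⟩)
  have hsum' (z : ℂ) (hz : z ∈ spectrum ℂ u) : ∑ i, f i z = 1 := by
    simpa using hsum hz
  have hcont (i : Fin n) : Continuous (fun z ↦ (f i z : ℂ)) := by fun_prop
  refine ⟨n, fun i ↦ e i, fun i ↦ cfc (fun z ↦ (f i z : ℂ)) u, fun i ↦ ?_, fun i ↦ ?_, ?_, ?_⟩
  · exact (spectrum.norm_le_norm_of_mem (hts (hmem i))).trans hu
  · exact cfc_nonneg fun z _ ↦ by exact_mod_cast (h01 i z).1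
  · rw [← cfc_sum_univ _ u (fun i ↦ (hcont i).continuousOn), ← cfc_one ℂ u]
    refine cfc_congr fun z hz ↦ ?_
    have := hsum' z hz
    simp only [Finset.sum_apply, Pi.one_apply]
    exact_mod_cast this
  · have key : u - ∑ i, e i • cfc (fun z ↦ (f i z : ℂ)) u =
        cfc (fun z ↦ z - ∑ i, e i * (f i z : ℂ)) u := by
      rw [cfc_sub _ _ u (by fun_prop) (by fun_prop), cfc_id' ℂ u]
      congr 1
      have h := cfc_sum_univ (fun i z ↦ e i * (f i z : ℂ)) u (fun i ↦ by fun_prop)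
      have h' : (∑ i, fun z ↦ e i * (f i z : ℂ)) = fun z ↦ ∑ i, e i * (f i z : ℂ) := by
        ext; simp
      rw [← h', h]
      exact Finset.sum_congr rfl fun i _ ↦ (cfc_const_mul _ _ u (by fun_prop)).symm
    rw [key]
    refine norm_cfc_le hε.le fun z hz ↦ ?_
    have hz1 : ∑ i, (f i z : ℂ) = 1 := by exact_mod_cast hsum' z hz
    have : z - ∑ i, e i * (f i z : ℂ) = ∑ i, (f i z : ℂ) * (z - e i) := by
      simp only [mul_sub, Finset.sum_sub_distrib, ← Finset.sum_mul, hz1, one_mul]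
      simp only [mul_comm]
    rw [this]
    calc ‖∑ i, (f i z : ℂ) * (z - e i)‖ ≤ ∑ i, f i z * ε := by
          refine norm_sum_le_of_le _ fun i _ ↦ ?_
          rw [norm_mul, Complex.norm_real, Real.norm_of_nonneg (h01 i z).1]
          by_cases hfz : f i z = 0
          · simp [hfz]
          · have := hf i (subset_tsupport _ hfz)
            exact mul_le_mul_of_nonneg_left (mem_ball_iff_norm.1 this).le (h01 i z).1
      _ = ε := by rw [← Finset.sum_mul, hsum' z hz, one_mul]

/-- A variance identity: `∑ (cᵢ - s)* bᵢ (cᵢ - s) = ∑ |cᵢ|² bᵢ - s* s` is positive, so `s* s ≤ 1`.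
-/
theorem norm_sum_smul_le_one_of_sum_eq_one {ι : Type*} [Fintype ι] {c : ι → ℂ} {b : ι → A}
    (hc : ∀ i, ‖c i‖ ≤ 1) (hb : ∀ i, 0 ≤ b i) (hsum : ∑ i, b i = 1) :
    ‖∑ i, c i • b i‖ ≤ 1 := by
  set s := ∑ i, c i • b i with hs
  have hstar : star s = ∑ i, star (c i) • b i := by
    simp [hs, star_sum, star_smul, (hb _).star_eq]
  have h0 : 0 ≤ ∑ i, star (c i • 1 - s) * b i * (c i • 1 - s) :=
    Finset.sum_nonneg fun i _ ↦ star_left_conjugate_nonneg (hb i) _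
  have h1 : ∑ i, star (c i • 1 - s) * b i * (c i • 1 - s) =
      ∑ i, (star (c i) * c i) • b i - star s * s := by
    have (i : ι) : star (c i • 1 - s) * b i * (c i • 1 - s) =
        (star (c i) * c i) • b i - (star (c i) • b i) * s - star s * (c i • b i)
          + star s * b i * s := by
      simp only [star_sub, star_smul, star_one, sub_mul, mul_sub, smul_mul_assoc, mul_smul_comm,
        one_mul, mul_one]
      rw [smul_sub, smul_smul, mul_comm (c i)]
      abel
    simp only [this, Finset.sum_add_distrib, Finset.sum_sub_distrib, ← Finset.sum_mul,
      ← Finset.mul_sum, hsum, ← hs, ← hstar]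
    simp
  have h2 : ∑ i, (star (c i) * c i) • b i ≤ 1 := by
    rw [← hsum]
    refine Finset.sum_le_sum fun i _ ↦ ?_
    have : star (c i) * c i = ((‖c i‖ ^ 2 : ℝ) : ℂ) := by
      simp [Complex.conj_mul']
    rw [this, Complex.coe_smul]
    exact smul_le_of_le_one_left (hb i) (by have := hc i; have := norm_nonneg (c i); nlinarith)
  have h3 : star s * s ≤ 1 := by
    rw [h1, sub_nonneg] at h0
    exact h0.trans h2
  rw [← CStarAlgebra.norm_le_one_iff_of_nonneg _ (star_mul_self_nonneg s),
    CStarRing.norm_star_mul_self] at h3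
  nlinarith [norm_nonneg s]

/-- If `‖a‖ < 1` and `u` is unitary, then `u + a` is the sum of two unitaries. -/
theorem exists_unitary_add_unitary_eq_unitary_add (u : unitary A) {a : A} (ha : ‖a‖ < 1) :
    ∃ v w : unitary A, (u : A) + a = v + w := by
  nontriviality A
  set x : A := u + a with hx
  have hu : IsUnit x := by
    have h : ‖-(star (u : A) * a)‖ < 1 := by
      rw [norm_neg]
      refine (norm_mul_le _ _).trans_lt ?_
      simpa using ha
    have := (Unitary.toUnits u).isUnit.mul (isUnit_one_sub_of_norm_lt_one h)
    convert this using 1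
    simp [hx, mul_add, ← mul_assoc]
  have habs : IsUnit (CFC.abs x) := by
    rw [← isUnit_pow_iff two_ne_zero, CFC.abs_sq]
    exact hu.star.mul hu
  obtain ⟨h, hh⟩ := habs
  have hsa : IsSelfAdjoint (CFC.abs x) := .of_nonneg (CFC.abs_nonneg x)
  have hinv : star (↑h⁻¹ : A) = ↑h⁻¹ := by
    rw [← Units.coe_star_inv, inv_inj.2 (Units.ext (by simp [hh, hsa.star_eq]) : star h = h)]
  -- Polar decomposition of the invertible `x`; then `|x| / 2` is a self-adjoint contraction, hence
  -- the real part of a unitary `w`.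
  have hv : x * ↑h⁻¹ ∈ unitary A := by
    refine (hu.mul h⁻¹.isUnit).mem_unitary_of_star_mul_self ?_
    rw [star_mul, hinv, mul_assoc, ← mul_assoc (star x), ← CFC.abs_mul_abs, ← hh]
    simp
  have hnorm : ‖(2⁻¹ : ℝ) • CFC.abs x‖ ≤ 1 := by
    rw [norm_smul, CFC.norm_abs]
    have : ‖x‖ ≤ 1 + 1 := norm_add_le_of_le (by simp) ha.le
    norm_num at this ⊢
    linarith
  let s : selfAdjoint A := ⟨(2⁻¹ : ℝ) • CFC.abs x, (IsSelfAdjoint.all (2⁻¹ : ℝ)).smul hsa⟩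
  let w := selfAdjoint.unitarySelfAddISMul s hnorm
  have hw : (w : A) + (star w : unitary A) = CFC.abs x := by
    rw [show ((star w : unitary A) : A) = _ from selfAdjoint.star_coe_unitarySelfAddISMul s hnorm,
      show (w : A) = _ from selfAdjoint.unitarySelfAddISMul_coe s hnorm]
    simp only [s]
    module
  refine ⟨⟨_, hv⟩ * w, ⟨_, hv⟩ * star w, ?_⟩
  rw [Submonoid.coe_mul, Submonoid.coe_mul, ← mul_add, hw, ← hh]
  simp [mul_assoc]

/-- `f` sends an approximating sum for `u` to a sum of the same kind, of norm at most 1; boundedness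
of `f` controls the error. -/
theorem PositiveLinearMap.norm_apply_unitary_le_one {B : Type*} [CStarAlgebra B] [PartialOrder B]
    [StarOrderedRing B] (f : A →ₚ[ℂ] B) (hf : f 1 = 1) (u : unitary A) : ‖f u‖ ≤ 1 := by
  obtain ⟨C, hC⟩ := f.exists_norm_apply_le
  have hu : ‖(u : A)‖ ≤ 1 := by
    nontriviality A
    simp
  refine le_of_forall_pos_le_add fun ε hε ↦ ?_
  have hδ : 0 < ε / (C + 1) := by positivity
  obtain ⟨n, c, b, hc, hb, hsum, hub⟩ := IsStarNormal.exists_norm_sub_sum_smul_le (u : A) hu hδ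
  have h1 : ‖f (∑ i, c i • b i)‖ ≤ 1 := by
    simp only [map_sum, map_smul]
    exact norm_sum_smul_le_one_of_sum_eq_one hc (fun i ↦ map_nonneg f (hb i))
      (by rw [← map_sum, hsum, hf])
  have h2 : ‖f (u - ∑ i, c i • b i)‖ ≤ ε := by
    refine (hC _).trans ((mul_le_mul_of_nonneg_left hub C.2).trans ?_)
    rw [NNReal.val_eq_coe, mul_div_assoc', div_le_iff₀ (by positivity)]
    nlinarith
  calc ‖f u‖ = ‖f (∑ i, c i • b i) + f (u - ∑ i, c i • b i)‖ := by rw [← map_add]; simp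
    _ ≤ 1 + ε := norm_add_le_of_le h1 h2

/-- The Russo–Dye theorem, in the form: the open unit ball lies in the closed convex hull of the
unitaries. -/
theorem ball_subset_closure_convexHull_unitary :
    Metric.ball (0 : A) 1 ⊆ closure (convexHull ℝ (unitary A : Set A)) := by
  intro a ha
  rw [mem_ball_zero_iff] at ha
  have step (c : A) (hc : c ∈ convexHull ℝ (unitary A : Set A)) :
      (2⁻¹ : ℝ) • (c + a) ∈ convexHull ℝ (unitary A : Set A) := by
    have hconv : Convex ℝ {c : A | (2⁻¹ : ℝ) • (c + a) ∈ convexHull ℝ (unitary A : Set A)} := by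
      intro x hx y hy s t hs ht hst
      have := convex_convexHull ℝ (unitary A : Set A) hx hy hs ht hst
      simp only [Set.mem_ofPred_eq]
      convert this using 1
      have : a = s • a + t • a := by rw [← add_smul, hst, one_smul]
      conv_lhs => rw [this]
      module
    refine convexHull_min ?_ hconv hc
    intro u hu
    obtain ⟨v, w, hvw⟩ := exists_unitary_add_unitary_eq_unitary_add ⟨u, hu⟩ ha
    simp only [Set.mem_ofPred_eq]
    rw [show u + a = v + w from hvw, smul_add]
    exact convex_convexHull ℝ _ (subset_convexHull ℝ _ v.2) (subset_convexHull ℝ _ w.2)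
      (by norm_num) (by norm_num) (by norm_num)
  -- The iterates of `c ↦ (c + a) / 2` started at `1`.
  let c (n : ℕ) : A := a + ((2⁻¹ : ℝ) ^ n) • (1 - a)
  have hc (n : ℕ) : c n ∈ convexHull ℝ (unitary A : Set A) := by
    induction n with
    | zero => simpa [c] using subset_convexHull ℝ _ (one_mem (unitary A))
    | succ n ih =>
      convert step _ ih using 1
      simp only [c, pow_succ]
      module
  have hlim : Filter.Tendsto c Filter.atTop (nhds (a + (0 : ℝ) • (1 - a))) :=
    ((tendsto_pow_atTop_nhds_zero_of_lt_one (by norm_num) (by norm_num)).smul_const _).const_add _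
  rw [zero_smul, add_zero] at hlim
  exact mem_closure_of_tendsto hlim (.of_forall hc)

/-- A unital positive linear map between unital C⋆-algebras is contractive. -/
theorem PositiveLinearMap.norm_apply_le_of_map_one {B : Type*} [CStarAlgebra B] [PartialOrder B]
    [StarOrderedRing B] (f : A →ₚ[ℂ] B) (hf : f 1 = 1) (a : A) : ‖f a‖ ≤ ‖a‖ := by
  have hball (a : A) (ha : ‖a‖ < 1) : ‖f a‖ ≤ 1 := by
    have hcont : Continuous f := map_continuous f
    have hclosed : IsClosed {a : A | ‖f a‖ ≤ 1} := isClosed_le (by fun_prop) continuous_const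
    have hconv : Convex ℝ {a : A | ‖f a‖ ≤ 1} := by
      intro x hx y hy s t hs ht hst
      simp only [Set.mem_ofPred_eq, ← Complex.coe_smul, map_add, map_smul] at hx hy ⊢
      refine (norm_add_le _ _).trans ?_
      simp only [norm_smul, Complex.norm_real, Real.norm_of_nonneg hs, Real.norm_of_nonneg ht]
      nlinarith
    exact closure_minimal (convexHull_min (fun u hu ↦ f.norm_apply_unitary_le_one hf ⟨u, hu⟩) hconv)
      hclosed (ball_subset_closure_convexHull_unitary (mem_ball_zero_iff.2 ha))
  refine le_of_forall_gt_imp_ge_of_dense fun r hr ↦ ?_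
  have hr0 : 0 < r := (norm_nonneg a).trans_lt hr
  have := hball ((r⁻¹ : ℂ) • a) (by
    rw [norm_smul, norm_inv, Complex.norm_real, Real.norm_of_nonneg hr0.le, inv_mul_lt_one₀ hr0]
    exact hr)
  rwa [map_smul, norm_smul, norm_inv, Complex.norm_real, Real.norm_of_nonneg hr0.le,
    inv_mul_le_one₀ hr0] at this

/-- A functional of norm at most `1` taking the value `1` at `1` is positive. -/
theorem StrongDual.nonneg_of_norm_le_one_of_map_one {φ : StrongDual ℂ A} (hφ : ‖φ‖ ≤ 1)
    (h1 : φ 1 = 1) {a : A} (ha : 0 ≤ a) : 0 ≤ φ a := by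
  have hle (x : A) : ‖φ x‖ ≤ ‖x‖ := by simpa using φ.le_of_opNorm_le hφ x
  have hsa : IsSelfAdjoint a := .of_nonneg ha
  have hre : 0 ≤ (φ a).re := by
    have hb : ‖algebraMap ℝ A ‖a‖ - a‖ ≤ ‖a‖ := by
      rw [CStarAlgebra.norm_le_iff_le_algebraMap _ (norm_nonneg a)
        (sub_nonneg.2 hsa.le_algebraMap_norm_self)]
      simpa using ha
    have h := (Complex.re_le_norm _).trans ((hle _).trans hb)
    rw [Algebra.algebraMap_eq_smul_one, ← Complex.coe_smul, map_sub, map_smul, h1] at h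
    simpa using h
  have him (t : ℝ) : ((φ a).im + t) ^ 2 ≤ ‖a‖ ^ 2 + t ^ 2 := by
    have e : star (a + (t * Complex.I : ℂ) • (1 : A)) * (a + (t * Complex.I : ℂ) • (1 : A)) =
        a * a + ((t ^ 2 : ℝ) : ℂ) • (1 : A) := by
      simp only [star_add, hsa.star_eq, star_smul, star_one, add_mul, mul_add, smul_mul_assoc,
        mul_smul_comm, one_mul, mul_one]
      have : star (t * Complex.I : ℂ) * (t * Complex.I) = ((t ^ 2 : ℝ) : ℂ) := by
        simp [Complex.ext_iff, sq]
      rw [smul_add, smul_smul, mul_comm (t * Complex.I : ℂ), this, show star (t * Complex.I : ℂ) = -(t * Complex.I) by simp, neg_smul]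
      abel
    have hn : ‖a + (t * Complex.I : ℂ) • (1 : A)‖ ^ 2 ≤ ‖a‖ ^ 2 + t ^ 2 := by
      have : ‖(1 : A)‖ ≤ 1 := by
        obtain _ | _ := subsingleton_or_nontrivial A
        · simp [Subsingleton.elim (1 : A) 0]
        · simp
      rw [sq, ← CStarRing.norm_star_mul_self, e]
      refine (norm_add_le _ _).trans ?_
      rw [norm_smul, Complex.norm_real, Real.norm_of_nonneg (sq_nonneg t), sq ‖a‖]
      exact add_le_add (norm_mul_le a a) (mul_le_of_le_one_right (sq_nonneg t) this)
    have h := (Complex.abs_im_le_norm _).trans (hle (a + (t * Complex.I : ℂ) • (1 : A)))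
    rw [map_add, map_smul, h1] at h
    refine le_trans ?_ hn
    rw [← sq_abs]
    have h' : |(φ a).im + t| ≤ ‖a + (t * Complex.I : ℂ) • (1 : A)‖ := by simpa using h
    gcongr
  have him0 : (φ a).im = 0 := by
    by_contra hne
    -- This `t` makes the cross term `2 * (φ a).im * t` equal to `2 * ‖a‖ ^ 2`, too large for `him`.
    have h := him (‖a‖ ^ 2 / (φ a).im)
    have e : (φ a).im * (‖a‖ ^ 2 / (φ a).im) = ‖a‖ ^ 2 := by field_simp
    have : 0 < (φ a).im ^ 2 := by positivity
    nlinarith [sq_nonneg ‖a‖]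
  rw [Complex.nonneg_iff]
  exact ⟨hre, him0.symm⟩

/-- The norm of a positive element is attained at a unital functional of norm `1`. -/
theorem exists_dual_norm_le_one_map_one_apply_eq_norm [Nontrivial A] {a : A} (ha : 0 ≤ a) :
    ∃ φ : StrongDual ℂ A, ‖φ‖ ≤ 1 ∧ φ 1 = 1 ∧ φ a = ‖a‖ := by
  -- Since `‖1 + a‖ = 1 + ‖a‖`, a functional norming `1 + a` must norm both summands.
  obtain ⟨φ, hφ, h⟩ := exists_dual_vector'' ℂ (1 + a)
  have hle (x : A) : ‖φ x‖ ≤ ‖x‖ := by simpa using φ.le_of_opNorm_le hφ x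
  have hn : 1 + ‖a‖ ≤ ‖1 + a‖ := by
    have h0 : (0 : A) ≤ 1 + a := add_nonneg zero_le_one ha
    have h1 : 1 ≤ ‖1 + a‖ := by
      simpa using CStarAlgebra.norm_le_norm_of_nonneg_of_le (zero_le_one (α := A))
        (le_add_of_nonneg_right ha)
    have h2 : ‖a‖ ≤ ‖1 + a‖ - 1 := by
      rw [CStarAlgebra.norm_le_iff_le_algebraMap a (by linarith) ha, map_sub, map_one,
        le_sub_iff_add_le, add_comm]
      exact (IsSelfAdjoint.of_nonneg h0).le_algebraMap_norm_self
    linarith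
  have hr : (φ 1).re + (φ a).re = ‖1 + a‖ := by
    have := congrArg Complex.re h
    simpa using this
  have h1 := hle 1
  rw [norm_one] at h1
  have h1r := (Complex.re_le_norm (φ 1)).trans h1
  have har := (Complex.re_le_norm (φ a)).trans (hle a)
  have e1 : (φ 1).re = 1 := by linarith
  have e2 : (φ a).re = ‖a‖ := by linarith
  have key (z : ℂ) (r : ℝ) (hz : ‖z‖ ≤ r) (hzr : z.re = r) : z = r := by
    have h := Complex.sq_norm z
    rw [Complex.normSq_apply] at h
    have : z.im = 0 := by
      have : z.im * z.im ≤ 0 := by nlinarith [norm_nonneg z]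
      nlinarith
    exact Complex.ext (by simpa using hzr) (by simpa using this)
  exact ⟨φ, hφ, by simpa using key _ 1 h1 e1, key _ _ (hle a) e2⟩

/-- Unital functionals of norm at most `1` detect positivity. -/
theorem nonneg_of_forall_dual_nonneg {a : A}
    (h : ∀ φ : StrongDual ℂ A, ‖φ‖ ≤ 1 → φ 1 = 1 → 0 ≤ φ a) : 0 ≤ a := by
  nontriviality A
  have hsa {b : A} (hb : IsSelfAdjoint b)
      (h : ∀ φ : StrongDual ℂ A, ‖φ‖ ≤ 1 → φ 1 = 1 → 0 ≤ φ b) : 0 ≤ b := by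
    have hd : 0 ≤ algebraMap ℝ A ‖b‖ - b := sub_nonneg.2 hb.le_algebraMap_norm_self
    obtain ⟨φ, hφ, h1, hφd⟩ := exists_dual_norm_le_one_map_one_apply_eq_norm hd
    have hφb := (Complex.nonneg_iff.1 (h φ hφ h1)).1
    have : ‖algebraMap ℝ A ‖b‖ - b‖ ≤ ‖b‖ := by
      have h' := congrArg Complex.re hφd
      rw [Algebra.algebraMap_eq_smul_one, ← Complex.coe_smul, map_sub, map_smul, h1] at h'
      rw [Algebra.algebraMap_eq_smul_one, ← Complex.coe_smul]
      simp only [smul_eq_mul, mul_one, Complex.sub_re, Complex.ofReal_re] at h'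
      linarith
    rw [CStarAlgebra.norm_le_iff_le_algebraMap _ (norm_nonneg b) hd] at this
    simpa using this
  have him (φ : StrongDual ℂ A) (hφ : ‖φ‖ ≤ 1) (h1 : φ 1 = 1) :
      φ (imaginaryPart a : A) = 0 := by
    have hreal (b : selfAdjoint A) : (φ b).im = 0 := by
      have e := CFC.posPart_sub_negPart (b : A) b.2
      rw [← e, map_sub, Complex.sub_im,
        ← (Complex.nonneg_iff.1 (StrongDual.nonneg_of_norm_le_one_of_map_one hφ h1
          (CFC.posPart_nonneg (b : A)))).2,
        ← (Complex.nonneg_iff.1 (StrongDual.nonneg_of_norm_le_one_of_map_one hφ h1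
          (CFC.negPart_nonneg (b : A)))).2, sub_zero]
    have h0 := (Complex.nonneg_iff.1 (h φ hφ h1)).2
    rw [← realPart_add_I_smul_imaginaryPart a, map_add, map_smul] at h0
    have hr := hreal (realPart a)
    refine Complex.ext ?_ (hreal _)
    simpa [hr] using h0.symm
  have h0 : (imaginaryPart a : A) = 0 := by
    refine le_antisymm ?_ (hsa (imaginaryPart a).2 fun φ hφ h1 ↦ (him φ hφ h1).ge)
    rw [← neg_nonneg]
    exact hsa (imaginaryPart a).2.neg fun φ hφ h1 ↦ by simp [him φ hφ h1]
  refine hsa ?_ h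
  rw [← realPart_add_I_smul_imaginaryPart a, h0, smul_zero, add_zero]
  exact (realPart a).2

end UnitalPositive

/-! ### States of non-unital algebras, via the unitization. -/

section States

open scoped CStarAlgebra

theorem norm_apply_le_of_mem_cstarStates {B : Type*} [NonUnitalCStarAlgebra B]
    [PartialOrder B] {ψ : StrongDual ℂ B} (hψ : ψ ∈ cstarStates B) (b : B) :
    ‖ψ b‖ ≤ ‖b‖ := by
  simpa using ψ.le_of_opNorm_le hψ.2.le b

variable {B : Type*} [NonUnitalCStarAlgebra B] [PartialOrder B] [StarOrderedRing B]

/-- The restriction of a state of the unitization is a multiple of a state. -/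
theorem eq_zero_or_exists_smul_mem_cstarStates {φ : StrongDual ℂ (Unitization ℂ B)}
    (hφ : ‖φ‖ ≤ 1) (h1 : φ 1 = 1) :
    (∀ b : B, φ b = 0) ∨
      ∃ ψ ∈ cstarStates B, ∃ r : ℝ, 0 ≤ r ∧ r ≤ 1 ∧ ∀ b : B, φ b = r * ψ b := by
  let ρ : StrongDual ℂ B := (φ.toLinearMap ∘ₗ Unitization.inrHom ℂ ℂ B).mkContinuous 1 fun b ↦ by
    have := φ.le_of_opNorm_le hφ (b : Unitization ℂ B)
    rw [Unitization.norm_inr] at this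
    exact this
  have hρ (b : B) : φ b = ρ b := rfl
  have hρ1 : ‖ρ‖ ≤ 1 := LinearMap.mkContinuous_norm_le _ zero_le_one _
  obtain h0 | h0 := eq_or_ne ρ 0
  · exact .inl fun b ↦ by simp [hρ, h0]
  have hn : ‖ρ‖ ≠ 0 := norm_ne_zero_iff.2 h0
  refine .inr ⟨((‖ρ‖⁻¹ : ℝ) : ℂ) • ρ, ⟨fun b hb ↦ ?_, ?_⟩, ‖ρ‖, norm_nonneg _, hρ1, fun b ↦ ?_⟩
  · have := StrongDual.nonneg_of_norm_le_one_of_map_one hφ h1 (Unitization.inr_nonneg_iff.2 hb)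
    rw [hρ] at this
    exact mul_nonneg (by exact_mod_cast inv_nonneg.2 (norm_nonneg ρ)) this
  · rw [norm_smul, Complex.norm_real, Real.norm_of_nonneg (by positivity), inv_mul_cancel₀ hn]
  · have : (‖ρ‖ : ℂ) ≠ 0 := by exact_mod_cast hn
    simp [hρ, this]

theorem nonneg_of_forall_cstarStates_nonneg {b : B} (h : ∀ ψ ∈ cstarStates B, 0 ≤ ψ b) :
    0 ≤ b := by
  rw [← Unitization.inr_nonneg_iff]
  refine nonneg_of_forall_dual_nonneg fun φ hφ h1 ↦ ?_
  obtain h0 | ⟨ψ, hψ, r, hr, -, hφψ⟩ := eq_zero_or_exists_smul_mem_cstarStates hφ h1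
  · exact (h0 b).ge
  · rw [hφψ]
    exact mul_nonneg (by exact_mod_cast hr) (h ψ hψ)

theorem norm_le_of_forall_cstarStates_norm_le {b : B} (hb : 0 ≤ b) {r : ℝ} (hr : 0 ≤ r)
    (h : ∀ ψ ∈ cstarStates B, ‖ψ b‖ ≤ r) : ‖b‖ ≤ r := by
  obtain ⟨φ, hφ, h1, hφb⟩ := exists_dual_norm_le_one_map_one_apply_eq_norm
    (Unitization.inr_nonneg_iff.2 hb)
  rw [Unitization.norm_inr] at hφb
  have hn : ‖b‖ = ‖φ b‖ := by rw [hφb]; simp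
  rw [hn]
  obtain h0 | ⟨ψ, hψ, s, hs, hs1, hφψ⟩ := eq_zero_or_exists_smul_mem_cstarStates hφ h1
  · simpa [h0] using hr
  · rw [hφψ, norm_mul, Complex.norm_real, Real.norm_of_nonneg hs]
    exact (mul_le_of_le_one_left (norm_nonneg _) hs1).trans (h ψ hψ)

variable (B) in
-- Without states, the preceding norm bound would hold vacuously with `r = 0`.
theorem cstarStates_nonempty [Nontrivial B] : (cstarStates B).Nonempty := by
  by_contra hne
  obtain ⟨b, hb⟩ := exists_ne (0 : B)
  have := norm_le_of_forall_cstarStates_norm_le (star_mul_self_nonneg b) le_rfl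
    fun ψ hψ ↦ (hne ⟨ψ, hψ⟩).elim
  rw [CStarRing.norm_star_mul_self] at this
  exact hb (norm_eq_zero.1 (by nlinarith [norm_nonneg b]))

theorem IsMulIdentity.star_eq {A : Type*} [Mul A] [StarMul A] {e : A} (he : IsMulIdentity e) :
    star e = e := by
  have h := (he (star e)).1
  have h' := congrArg star h
  rw [star_mul, star_star] at h'
  exact h.symm.trans h'

theorem IsMulIdentity.norm_le_one {A : Type*} [NonUnitalCStarAlgebra A] {e : A}
    (he : IsMulIdentity e) : ‖e‖ ≤ 1 := by
  have h := CStarRing.norm_star_mul_self (x := e)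
  rw [he.star_eq, (he e).1] at h
  by_contra! hlt
  nlinarith

/-- Cauchy–Schwarz for the GNS form gives `|ψ b|² ≤ ψ e * ψ (b* b)`, hence `1 = ‖ψ‖ ≤ √(ψ e)`. -/
theorem cstarStates_apply_eq_one {ψ : StrongDual ℂ B} (hψ : ψ ∈ cstarStates B) {e : B}
    (he : IsMulIdentity e) : ψ e = 1 := by
  have hee : star e * e = e := by rw [he.star_eq, (he e).1]
  have he0 : 0 ≤ e := hee ▸ star_mul_self_nonneg e
  obtain ⟨hre, him⟩ := Complex.nonneg_iff.1 (hψ.1 e he0)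
  have hle : (ψ e).re ≤ 1 :=
    (Complex.re_le_norm _).trans ((norm_apply_le_of_mem_cstarStates hψ e).trans he.norm_le_one)
  let f : B →ₚ[ℂ] ℂ := .mk₀ ψ.toLinearMap hψ.1
  have hf (b : B) : f b = ψ b := rfl
  have hcs (b : B) : ‖ψ b‖ ≤ √(ψ e).re * ‖b‖ := by
    have h := norm_inner_le_norm (𝕜 := ℂ) (f.toPreGNS e) (f.toPreGNS b)
    rw [f.preGNS_inner_def, f.preGNS_norm_def, f.preGNS_norm_def] at h
    simp only [f.ofPreGNS_toPreGNS, hf, he.star_eq, (he _).1] at h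
    refine h.trans (mul_le_mul_of_nonneg_left ?_ (Real.sqrt_nonneg _))
    rw [Real.sqrt_le_left (norm_nonneg b), sq, ← CStarRing.norm_star_mul_self]
    exact (Complex.re_le_norm _).trans (norm_apply_le_of_mem_cstarStates hψ _)
  have h1 : 1 ≤ √(ψ e).re := hψ.2 ▸ ψ.opNorm_le_bound (Real.sqrt_nonneg _) hcs
  rw [Real.one_le_sqrt] at h1
  exact Complex.ext (by simpa using le_antisymm hle h1) (by simpa using him.symm)

/-- A positive contraction dominating every positive contraction is a multiplicative identity. -/
theorem isMulIdentity_of_forall_le {p : B} (hp : ‖p‖ ≤ 1)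
    (h : ∀ c : B, 0 ≤ c → ‖c‖ ≤ 1 → c ≤ p) : IsMulIdentity p := by
  have hp0 : 0 ≤ p := h 0 le_rfl (by simp)
  have hleft (b : B) : p * b = b := by
    have hl := CStarAlgebra.increasingApproximateUnit B
    have hlim : Filter.Tendsto (fun x ↦ √(‖b‖ * ‖b - x * b‖)) (CStarAlgebra.approximateUnit B)
        (nhds √(‖b‖ * ‖b - b‖)) :=
      (((hl.tendsto_mul_right b).const_sub b).norm.const_mul ‖b‖).sqrt
    rw [sub_self, norm_zero, mul_zero, Real.sqrt_zero] at hlim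
    have hle : ‖b - p * b‖ ≤ 0 := by
      refine ge_of_tendsto hlim ?_
      filter_upwards [hl.eventually_nonneg, hl.eventually_norm] with x hx0 hx1
      -- As `p` lies above the approximate unit, it approximates `b` at least as well, up to the
      -- square root.
      refine CStarAlgebra.norm_sub_mul_self_le_of_inr b hx0 (h x hx0 hx1) hp (Real.sqrt_nonneg _) ?_
      rw [Real.sq_sqrt (by positivity), mul_assoc, sub_mul, one_mul]
      refine (norm_mul_le _ _).trans_eq ?_
      rw [norm_star, ← Unitization.inr_mul, ← Unitization.inr_sub, Unitization.norm_inr,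
        Unitization.norm_inr]
    rw [norm_le_zero_iff, sub_eq_zero] at hle
    exact hle.symm
  refine fun b ↦ ⟨hleft b, ?_⟩
  simpa [hp0.star_eq] using congrArg star (hleft (star b))

end States

/-! ### From positive elements to all elements. -/

section Contraction

open scoped CStarAlgebra

variable {A B : Type*} [NonUnitalCStarAlgebra A] [PartialOrder A] [StarOrderedRing A]
  [NonUnitalCStarAlgebra B] [PartialOrder B] [StarOrderedRing B]

/-- Compressing `x = r + a` by `n = a⁻` gives `0 ≤ r n² - n³`, so `‖n³‖ ≤ r ‖n‖²`, while `‖n‖⁴ ≤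
‖n³‖ ‖n‖`. -/
theorem Unitization.norm_negPart_snd_le_of_nonneg {x : Unitization ℂ A} (hx : 0 ≤ x) :
    ‖x.snd⁻‖ ≤ x.fst.re := by
  obtain ⟨y, hy⟩ := CStarAlgebra.nonneg_iff_eq_star_mul_self.1 hx
  have hfst : 0 ≤ x.fst := by
    rw [hy, fst_mul, fst_star]
    exact star_mul_self_nonneg _
  obtain ⟨hr, him⟩ := Complex.nonneg_iff.1 hfst
  have hrx : x.fst = (x.fst.re : ℂ) := Complex.ext rfl (by simpa using him.symm)
  have ha : IsSelfAdjoint x.snd := by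
    rw [isSelfAdjoint_iff, ← snd_star, hx.star_eq]
  set n := x.snd⁻ with hn
  have hn0 : 0 ≤ n := CFC.negPart_nonneg _
  have hconj : n * x.snd * n = -(n * n * n) := by
    have := CFC.posPart_sub_negPart x.snd ha
    rw [← hn] at this
    rw [← this, mul_sub, CFC.negPart_mul_posPart]
    simp
  have h1 : 0 ≤ (n : Unitization ℂ A) * x * n := by
    have := star_left_conjugate_nonneg hx (n : Unitization ℂ A)
    rwa [← inr_star, hn0.star_eq] at this
  have h2 : (n : Unitization ℂ A) * x * n = ((x.fst.re • (n * n) - n * n * n : A) :) := by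
    conv_lhs => rw [← inl_fst_add_inr_snd_eq x, hrx]
    rw [mul_add, add_mul, inr_mul_inl, ← inr_mul, ← inr_mul, ← inr_mul, hconj, ← inr_add,
      smul_mul_assoc, sub_eq_add_neg]
    simp
  rw [h2, inr_nonneg_iff, sub_nonneg] at h1
  have hnnn : 0 ≤ n * n * n := by
    have := star_left_conjugate_nonneg hn0 n
    rwa [hn0.star_eq] at this
  have h3 := CStarAlgebra.norm_le_norm_of_nonneg_of_le hnnn h1
  have hsq : ‖n * n‖ = ‖n‖ ^ 2 := by
    rw [hn0.isSelfAdjoint.norm_mul_self]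
  rw [norm_smul, Real.norm_of_nonneg hr, hsq] at h3
  have h4 : ‖n‖ ^ 2 * ‖n‖ ^ 2 ≤ ‖n * n * n‖ * ‖n‖ := by
    have hs : IsSelfAdjoint (n * n) := by
      rw [isSelfAdjoint_iff, star_mul, hn0.star_eq]
    have := hs.norm_mul_self
    rw [hsq, ← mul_assoc] at this
    calc ‖n‖ ^ 2 * ‖n‖ ^ 2 = ‖n * n * n * n‖ := by rw [this]; ring
      _ ≤ _ := norm_mul_le _ _
  by_contra! hlt
  have hpos : 0 < ‖n‖ := hr.trans_lt hlt
  have : 0 < ‖n‖ ^ 3 := by positivity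
  nlinarith [mul_le_mul_of_nonneg_right h3 hpos.le]

/-- A positive map that is contractive on positive elements is contractive. -/
theorem LinearMap.norm_apply_le_of_forall_nonneg (Ψ : A →ₗ[ℂ] B)
    (hpos : ∀ a, 0 ≤ a → 0 ≤ Ψ a) (hle : ∀ a, 0 ≤ a → ‖Ψ a‖ ≤ ‖a‖) (a : A) : ‖Ψ a‖ ≤ ‖a‖ := by
  let F : Unitization ℂ A →ₗ[ℂ] Unitization ℂ B :=
    { toFun x := algebraMap ℂ _ x.fst + (Ψ x.snd : Unitization ℂ B)
      map_add' x y := by simp; abel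
      map_smul' c x := by simp [Algebra.algebraMap_eq_smul_one, smul_smul] }
  have hF (x : Unitization ℂ A) : F x = algebraMap ℂ _ x.fst + (Ψ x.snd : Unitization ℂ B) := rfl
  have hFpos (x : Unitization ℂ A) (hx : 0 ≤ x) : 0 ≤ F x := by
    have hn := Unitization.norm_negPart_snd_le_of_nonneg hx
    have hr : 0 ≤ x.fst.re := (norm_nonneg _).trans hn
    have hn0 : 0 ≤ x.snd⁻ := CFC.negPart_nonneg _
    have ha : IsSelfAdjoint x.snd := by
      rw [isSelfAdjoint_iff, ← Unitization.snd_star, hx.star_eq]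
    have him : x.fst = (x.fst.re : ℂ) := by
      refine (Complex.conj_eq_iff_re.1 ?_).symm
      rw [starRingEnd_apply, ← Unitization.fst_star, hx.star_eq]
    have h1 : (Ψ x.snd⁻ : Unitization ℂ B) ≤ algebraMap ℝ _ x.fst.re := by
      rw [← CStarAlgebra.norm_le_iff_le_algebraMap _ hr
        (Unitization.inr_nonneg_iff.2 (hpos _ hn0)), Unitization.norm_inr]
      exact (hle _ hn0).trans hn
    have h2 : 0 ≤ (Ψ x.snd⁺ : Unitization ℂ B) :=
      Unitization.inr_nonneg_iff.2 (hpos _ (CFC.posPart_nonneg _))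
    -- The scalar part absorbs `Ψ a⁻`, because `‖Ψ a⁻‖ ≤ ‖a⁻‖ ≤ r`.
    have h3 : F x = (algebraMap ℝ _ x.fst.re - (Ψ x.snd⁻ : Unitization ℂ B))
        + (Ψ x.snd⁺ : Unitization ℂ B) := by
      have e := congrArg Ψ (CFC.posPart_sub_negPart x.snd ha)
      rw [map_sub] at e
      rw [hF, ← e, Unitization.inr_sub, him, Complex.ofReal_re,
        Algebra.algebraMap_eq_smul_one (R := ℝ), Algebra.algebraMap_eq_smul_one, Complex.coe_smul]
      abel
    rw [h3]
    exact add_nonneg (sub_nonneg.2 h1) h2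
  have h := (PositiveLinearMap.mk₀ F hFpos).norm_apply_le_of_map_one
    (by change F 1 = 1; simp [hF]) (a : Unitization ℂ A)
  change ‖F a‖ ≤ _ at h
  simpa [hF, Unitization.norm_inr] using h

end Contraction
-- The main theorem.
theorem mainTheorem2 {A B : Type*}
    [NonUnitalCStarAlgebra A] [PartialOrder A] [StarOrderedRing A]
    [NonUnitalCStarAlgebra B] [PartialOrder B] [StarOrderedRing B] [Nontrivial B]
    (Ψ : A →ₗ[ℂ] B)
    (hΨ : ∀ φ ∈ cstarStates B, ∃ ψ ∈ cstarStates A,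
      (ψ : A →ₗ[ℂ] ℂ) = (φ : B →ₗ[ℂ] ℂ) ∘ₗ Ψ) :
    (∀ a : A, 0 ≤ a → 0 ≤ Ψ a) ∧
    (∀ a : A, ‖Ψ a‖ ≤ ‖a‖) ∧
    (∃ Φ : A →L[ℂ] B, (Φ : A →ₗ[ℂ] B) = Ψ ∧ ‖Φ‖ = 1) ∧
    (∀ e : A, IsMulIdentity e → ∃ f : B, IsMulIdentity f ∧ Ψ e = f) := by
  have hΨ' (φ) (hφ : φ ∈ cstarStates B) : ∃ ψ ∈ cstarStates A, ∀ a, φ (Ψ a) = ψ a := by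
    obtain ⟨ψ, hψ, h⟩ := hΨ φ hφ
    exact ⟨ψ, hψ, fun a ↦ (LinearMap.congr_fun h a).symm⟩
  have hpos (a : A) (ha : 0 ≤ a) : 0 ≤ Ψ a := by
    refine nonneg_of_forall_cstarStates_nonneg fun φ hφ ↦ ?_
    obtain ⟨ψ, hψ, h⟩ := hΨ' φ hφ
    exact h a ▸ hψ.1 a ha
  have hle : ∀ a, ‖Ψ a‖ ≤ ‖a‖ := by
    refine Ψ.norm_apply_le_of_forall_nonneg hpos fun a ha ↦ ?_
    refine norm_le_of_forall_cstarStates_norm_le (hpos a ha) (norm_nonneg a) fun φ hφ ↦ ?_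
    obtain ⟨ψ, hψ, h⟩ := hΨ' φ hφ
    exact h a ▸ norm_apply_le_of_mem_cstarStates hψ a
  refine ⟨hpos, hle, ⟨Ψ.mkContinuous 1 (by simpa using hle), rfl, ?_⟩, fun e he ↦ ⟨Ψ e, ?_, rfl⟩⟩
  · refine le_antisymm (Ψ.mkContinuous_norm_le zero_le_one _) ?_
    set Φ := Ψ.mkContinuous 1 (by simpa using hle)
    obtain ⟨φ, hφ⟩ := cstarStates_nonempty B
    obtain ⟨ψ, hψ, h⟩ := hΨ' φ hφ
    rw [← hψ.2]
    refine ψ.opNorm_le_bound (norm_nonneg _) fun a ↦ ?_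
    rw [← h]
    exact (norm_apply_le_of_mem_cstarStates hφ _).trans (Φ.le_opNorm a)
  · refine isMulIdentity_of_forall_le ((hle e).trans he.norm_le_one) fun c hc hc1 ↦ ?_
    rw [← sub_nonneg]
    refine nonneg_of_forall_cstarStates_nonneg fun φ hφ ↦ ?_
    obtain ⟨ψ, hψ, h⟩ := hΨ' φ hφ
    -- What remains is `φ c ≤ 1`, which holds since `‖φ c‖ ≤ ‖c‖ ≤ 1`.
    rw [map_sub, h, cstarStates_apply_eq_one hψ he, sub_nonneg]
    have hφc := Complex.eq_coe_norm_of_nonneg (hφ.1 c hc)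
    rw [hφc]
    exact_mod_cast (norm_apply_le_of_mem_cstarStates hφ c).trans hc1
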